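/- **Setting.** An instance consists of a set $N=[n]$ of agents, a budget $B>0$, costs $c_i\in(0,B]$, and a valuation $v:2^N\to\mathbb R_{\ge 0}$ with $v(\emptyset)=0$ that is submodular, i.e. $v(i\mid S)\ge v(i\mid T)$ for all $S\subseteq T$, $i\notin T$, where $v(i\mid S)=v(S\cup\{i\})-v(S)$; $v$ need not be monotone. Write $v(i)=v(\{i\})$. A set $S$ is feasible if $\sum_{i\in S}c_i\le B$, and $S^*$ is a feasible set of maximum value. The agents arrive in uniformly random order; expectations are over this order and the coins of the mechanism. The set returned by a mechanism $M$ is $A_M$. *Pricing procedure with threshold $t$ on a sequence of agents.* Set $S_1=S_2=\emptyset$, $B_1=B_2=B$ and draw $j^\ast\in\{1,2\}$ uniformly in advance. For each arriving $i$ let $j\in\{1,2\}$ maximize $v(i\mid S_j)$ (with $j=1$ in case of a tie) and $\bar p_i=\frac Bt v(i\mid S_j)$; if $c_i\le\bar p_i$ and $B_j-\bar p_i\ge0$, add $i$ to $S_j$, set her price to $\bar p_i$ and decrease $B_j$ by $\bar p_i$. Return $S_{j^\ast}$, pay its members their prices and everybody else $0$. (If $t=0$ nobody is hired.) *Mechanism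 6* (parameters $p\in[0,1]$, $a>0$, $z_1>0$, prediction $\omega$). With probability $p$ return the first agent $j$ with $v(j)\ge a\omega/z_1$, if any, and pay her $B$. With probability $1-p$ run the pricing procedure with $t=a\omega$ on all agents. *Mechanism 7* (parameters $q\in[0,1]$, $\beta>0$). With probability $q$ run Dynkin's algorithm: reject the first $\lfloor n/e\rfloor$ agents, let $i^*$ be the most valuable of them, return the first later agent $j$ with $v(j)\ge v(i^*)$, if any, and pay her $B$; here agents are compared by their values $v(i)$, and ties between agents of equal value are broken consistently by a fixed order of the agents (if the sample is empty, the first agent is returned). With probability $1-q$ draw $\xi_1$ from the binomial distribution $\mathcal B(n,\frac12)$, let $N_1$ be the set of the first $\xi_1$ agents, let $T_1$ be a $\frac1e$-approximate solution on $N_1$, i.e. a feasible $T_1\subseteq N_1$ with $v(T_1)\ge\frac1e v(S)$ for every feasible $S\subseteq N_1$, computed by any fixed (possibly randomized) subroutine that always outputs such a set, and run the pricing procedure with $t=\beta v(T_1)$ on the remaining agents. *Mechanism 5* (parameter $\tau\in[0,1)$) runs Mechanism 6 with probability $\tau$ and Mechanism 7 with probability $1-\tau$. **Theorem.** Let $\omega=(1-\varepsilon)v(S^*)$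 with $\varepsilon\in[0,1)$, let $\tau\in[0,1)$, $p,q\in[0,1]$, $a,z_1,\beta,\delta>0$ and $z_2\ge1$. Put $$f_1=\min\Big\{\tfrac{a(1-\varepsilon)p}{z_1},\ (1-p)\Big(\tfrac14-\tfrac{(1-\varepsilon)a}{2}\Big),\ (1-p)\,a(1-\varepsilon)\tfrac{z_1-1}{2z_1}\Big\},$$ $$f_2=\min\Big\{\tfrac qe\cdot\tfrac{\beta}{z_2}\cdot\tfrac1e\Big(\tfrac12-\delta\Big),\ (1-q)\,\tilde p\,\Big(\tfrac18-\tfrac\delta4-\tfrac\beta2\Big),\ (1-q)\,\tilde p\,\tfrac{z_2-1}{2z_2}\cdot\tfrac\beta e\Big(\tfrac12-\delta\Big)\Big\},$$ $$\tilde p=1-2\exp\left(-\frac{\delta^2/2}{\frac{\beta}{z_2e}\left(\frac12-\delta\right)\left(\frac14+\frac\delta3\right)}\right)$$ (for $\delta=\frac12$, where the fraction is undefined, read it as $0$; then $f_2\le0$). Then Mechanism 6 satisfies $\mathbb E[v(A_6)]\ge f_1\,v(S^*)$, Mechanism 7 satisfies $\mathbb E[v(A_7)]\ge f_2\,v(S^*)$,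 and Mechanism 5 satisfies $\mathbb E[v(A_5)]\ge(\tau f_1+(1-\tau)f_2)\,v(S^*)$. In particular, whenever $\tau f_1+(1-\tau)f_2>0$, Mechanism 5 has competitive ratio $(\tau f_1+(1-\tau)f_2)^{-1}$, i.e. $v(S^*)\le(\tau f_1+(1-\tau)f_2)^{-1}\,\mathbb E[v(A_5)]$. -/

import Mathlib

namespace BudgetFeasible

/-- An instance of the procurement problem: `n` agents with costs in `(0, B]`, a budget `B > 0`,
and a normalised, non-negative, submodular (not necessarily monotone) valuation function. -/
structure Instance (n : ℕ) where
  cost : Fin n → ℝ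
  value : Finset (Fin n) → ℝ
  budget : ℝ
  budget_pos : 0 < budget
  cost_pos : ∀ i, 0 < cost i
  cost_le_budget : ∀ i, cost i ≤ budget
  value_empty : value ∅ = 0
  value_nonneg : ∀ S, 0 ≤ value S
  submodular : ∀ (S T : Finset (Fin n)) (i : Fin n), S ⊆ T → i ∉ T →
    value (insert i T) - value T ≤ value (insert i S) - value S

/-- What a mechanism returns: the hired agents and the payments. -/
structure Outcome (n : ℕ) where
  winners : Finset (Fin n)
  payment : Fin n → ℝ

namespace Instance

variable {n : ℕ} (I : Instance n)

/-- The marginal value `v(i | S)`. -/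
def marginal (i : Fin n) (S : Finset (Fin n)) : ℝ := I.value (insert i S) - I.value S

/-- `S` respects the budget with respect to the agents' costs. -/
def Feasible (S : Finset (Fin n)) : Prop := ∑ i ∈ S, I.cost i ≤ I.budget

/-- `S` is an optimal solution of the offline problem. -/
def IsOptimal (S : Finset (Fin n)) : Prop :=
  I.Feasible S ∧ ∀ T, I.Feasible T → I.value T ≤ I.value S

/-- `T` is an `α`-approximate solution of the offline problem restricted to the agents in `M`. -/
def IsApproxSolution (α : ℝ) (M T : Finset (Fin n)) : Prop :=
  T ⊆ M ∧ I.Feasible T ∧ ∀ S ⊆ M, I.Feasible S → α * I.value S ≤ I.value T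

/-- Hire the first agent of the list that satisfies `P` (if any) and pay her the whole budget. -/
noncomputable def hireFirst (P : Fin n → Prop) (l : List (Fin n)) : Outcome n :=
  open Classical in
  match l.find? (fun j => decide (P j)) with
  | none => ⟨∅, 0⟩
  | some j => ⟨{j}, Pi.single j I.budget⟩

/-- `j` is at least as valuable as `i`, where ties between different agents of the same value
are broken in favour of the larger label. -/
def Beats (j i : Fin n) : Prop :=
  I.value {i} < I.value {j} ∨ (I.value {i} = I.value {j} ∧ i ≤ j)

/-- Dynkin's algorithm: reject the first `⌊n / e⌋` agents and hire the first later agent that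
beats the most valuable one of them, i.e. that beats all of them. -/
noncomputable def dynkin (arrivals : List (Fin n)) : Outcome n :=
  let r := ⌊(n : ℝ) / Real.exp 1⌋₊
  I.hireFirst (fun j => ∀ i ∈ arrivals.take r, I.Beats j i) (arrivals.drop r)

end Instance

/-- State of the two-solution posted-price procedure: the two solutions `S₁, S₂` built so far
(indices `0, 1`), their remaining budgets, and the price accepted by each agent added so far. -/
structure PricingState (n : ℕ) where
  sol : Fin 2 → Finset (Fin n)
  remaining : Fin 2 → ℝ
  price : Fin n → ℝ

namespace Instance

variable {n : ℕ} (I : Instance n)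

/-- One round of the posted-price procedure with threshold `t`, when agent `i` arrives. The agent
is considered for the solution to which she has the larger marginal value (for `S₁` if equal).
If `t = 0` no price can be posted and nobody is hired: the expression `B / 0` is `0` and costs
are positive. -/
noncomputable def pricingStep (t : ℝ) (s : PricingState n) (i : Fin n) : PricingState n :=
  let j : Fin 2 := if I.marginal i (s.sol 1) ≤ I.marginal i (s.sol 0) then 0 else 1
  let pr : ℝ := I.budget / t * I.marginal i (s.sol j)
  if I.cost i ≤ pr ∧ 0 ≤ s.remaining j - pr then
    { sol := Function.update s.sol j (insert i (s.sol j))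
      remaining := Function.update s.remaining j (s.remaining j - pr)
      price := Function.update s.price i pr }
  else s

/-- The final state of the posted-price procedure with threshold `t`, run on the given list of
arriving agents, starting from two empty solutions, each with its own budget `B`. -/
noncomputable def runPricing (t : ℝ) (arrivals : List (Fin n)) : PricingState n :=
  arrivals.foldl (I.pricingStep t) ⟨fun _ => ∅, fun _ => I.budget, fun _ => 0⟩

/-- Build two solutions by posted prices and return the one with a uniformly random index;
agents outside of it are paid nothing. -/
noncomputable def twoSolutions (t : ℝ) (arrivals : List (Fin n)) : PMF (Outcome n) :=
  (PMF.uniformOfFintype (Fin 2)).map fun j =>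
    let s := I.runPricing t arrivals
    ⟨s.sol j, fun i => if i ∈ s.sol j then s.price i else 0⟩

end Instance

/-- With probability `p` run `μ`, with probability `1 - p` run `ν`. -/
noncomputable def mix {α : Type} (p : unitInterval) (μ ν : PMF α) : PMF α :=
  (ProbabilityTheory.bernoulliMeasure true false p).toPMF.bind fun b => if b then μ else ν

/-- The binomial distribution with `n` trials and success probability `1 / 2`. -/
noncomputable def fairBinomial (n : ℕ) : PMF ℕ :=
  (ProbabilityTheory.binomial n ⟨1 / 2, by norm_num, by norm_num⟩).toPMF

namespace Instance

variable {n : ℕ} (I : Instance n)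

/-- The mechanism that uses the prediction `ω`, on a fixed arrival sequence. -/
noncomputable def predictionMechanism (p : unitInterval) (a z ω : ℝ) (arrivals : List (Fin n)) :
    PMF (Outcome n) :=
  mix p
    (PMF.pure (I.hireFirst (fun j => a * ω / z ≤ I.value {j}) arrivals))
    (I.twoSolutions (a * ω) arrivals)

/-- The mechanism that ignores the prediction, on a fixed arrival sequence. The (possibly
randomized) offline subroutine `solver` computes the solution `T₁` on the set `N₁` of sampled
agents. -/
noncomputable def samplingMechanism (q : unitInterval) (β : ℝ)
    (solver : Finset (Fin n) → PMF (Finset (Fin n))) (arrivals : List (Fin n)) :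
    PMF (Outcome n) :=
  mix q
    (PMF.pure (I.dynkin arrivals))
    ((fairBinomial n).bind fun ξ =>
      (solver (arrivals.take ξ).toFinset).bind fun T₁ =>
        I.twoSolutions (β * I.value T₁) (arrivals.drop ξ))

/-- The combined mechanism: with probability `τ` the prediction is used, otherwise ignored. -/
noncomputable def combinedMechanism (τ p q : unitInterval) (a z₁ ω β : ℝ)
    (solver : Finset (Fin n) → PMF (Finset (Fin n))) (arrivals : List (Fin n)) :
    PMF (Outcome n) :=
  mix τ (I.predictionMechanism p a z₁ ω arrivals) (I.samplingMechanism q β solver arrivals)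

/-- The expected value `𝔼[v(A)]` of the set of hired agents, when the agents arrive in uniformly
random order; the expectation is over the arrival order and the coins of the mechanism `M`. -/
noncomputable def expectedValue (M : List (Fin n) → PMF (Outcome n)) : ℝ :=
  let winners : PMF (Finset (Fin n)) :=
    (PMF.uniformOfFintype (Equiv.Perm (Fin n))).bind fun π =>
      (M (List.ofFn π)).map Outcome.winners
  ∑ S, (winners S).toReal * I.value S

end Instance

/-- The ratio guaranteed by the mechanism that uses the prediction. -/
noncomputable def f₁ (p a z ε : ℝ) : ℝ :=
  min (a * (1 - ε) * p / z)
    (min ((1 - p) * (1 / 4 - (1 - ε) * a / 2))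
      ((1 - p) * a * (1 - ε) * ((z - 1) / (2 * z))))

/-- The lower bound on the probability that both sampled halves of an optimal solution are
valuable. -/
noncomputable def pTilde (β z δ : ℝ) : ℝ :=
  1 - 2 * Real.exp (-((δ ^ 2 / 2) /
    ((β / (z * Real.exp 1) * (1 / 2 - δ)) * (1 / 4 + δ / 3))))

/-- The ratio guaranteed by the mechanism that ignores the prediction. -/
noncomputable def f₂ (q β z δ : ℝ) : ℝ :=
  min (q / Real.exp 1 * (β / z) * (1 / Real.exp 1) * (1 / 2 - δ))
    (min ((1 - q) * pTilde β z δ * (1 / 8 - δ / 4 - β / 2))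
      ((1 - q) * pTilde β z δ *
        ((z - 1) / (2 * z) * (β / Real.exp 1) * (1 / 2 - δ))))

end BudgetFeasible

/-! Prices proportional to marginals make the payments for a solution $S_j$ telescope to $\frac Bt
v(S_j)$. Hence an agent $i$ refused for lack of budget certifies $v(S_j)+v(i)>t$. If this never
happens, every agent in neither solution was refused on price, so her marginal to either solution is
at most $tc_i/B$, and these bounds sum to at most $t$ over a feasible set $O$. The members of $O$ in
the other solution add at most the value of that solution, because each of them joined where her
marginal was larger. Thus $v(S_j\cup O)\le v(S_1)+v(S_2)+t$ for both $j$. Disjointness and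
nonnegativity replace monotonicity: $v(O)\le v(S_1\cup O)+v(S_2\cup O)$. With all singletons at most
$\theta$, the random solution is therefore worth at least $(t-\theta)/2$ or $v(O)/4-t/2$ on average
(`runPricing_guarantee`).

Both mechanisms hedge on singletons. If some agent is large, hiring a single agent suffices: by a
value threshold when $\omega$ is known, by Dynkin's rule with success probability $1/e$ otherwise
(`dynkin_guarantee`). If all agents are small, pricing works, provided that the threshold is right.
Without a prediction the threshold comes from a sample, and the binomial sample size makes the
sample a uniformly random subset. The optimum is split into nonnegative additive weights bounded by
the singleton values (`exists_weights`). Hoeffding's inequality then shows that the sample and its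
complement each retain value at least $(\frac12-\delta)v(S^*)$ with probability at least $\tilde p$.
-/

namespace BudgetFeasible
namespace Instance

variable {n : ℕ} (I : Instance n)

/-! ### Expected values of random outcomes -/

/-- The expected value of the set of hired agents under a random outcome. -/
noncomputable def mean (μ : PMF (Outcome n)) : ℝ :=
  ∑ S, (μ.map Outcome.winners S).toReal * I.value S

theorem mean_nonneg (μ : PMF (Outcome n)) : 0 ≤ I.mean μ :=
  Finset.sum_nonneg fun S _ => mul_nonneg ENNReal.toReal_nonneg (I.value_nonneg S)

theorem mean_pure (o : Outcome n) : I.mean (PMF.pure o) = I.value o.winners := by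
  classical
  simp only [mean, PMF.pure_map, PMF.pure_apply]
  rw [Finset.sum_eq_single o.winners] <;> simp +contextual

/-- Stated as `HasSum` because the binomial coin ranges over the infinite type `ℕ`; the finite forms
follow by uniqueness of sums. -/
theorem hasSum_mean_bind {α : Type} (μ : PMF α) (κ : α → PMF (Outcome n)) :
    HasSum (fun a => (μ a).toReal * I.mean (κ a)) (I.mean (μ.bind κ)) := by
  have h : ∀ S, HasSum (fun a => (μ a).toReal * ((κ a).map Outcome.winners S).toReal)
      (((μ.bind κ).map Outcome.winners S).toReal) := by
    intro S
    rw [PMF.map_bind, PMF.bind_apply, ENNReal.tsum_toReal_eq]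
    · simp_rw [ENNReal.toReal_mul]
      have hs : Summable fun a => (μ a * ((κ a).map Outcome.winners) S).toReal := by
        apply ENNReal.summable_toReal
        rw [← PMF.bind_apply]
        exact PMF.apply_ne_top _ _
      simpa only [ENNReal.toReal_mul] using hs.hasSum
    · exact fun a => ENNReal.mul_ne_top (PMF.apply_ne_top _ _) (PMF.apply_ne_top _ _)
  have := hasSum_sum (s := Finset.univ) fun S _ => (h S).mul_right (I.value S)
  simp only [mul_assoc, ← Finset.mul_sum] at this
  exact this

theorem mean_bind_fintype {α : Type} [Fintype α] (μ : PMF α) (κ : α → PMF (Outcome n)) :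
    I.mean (μ.bind κ) = ∑ a, (μ a).toReal * I.mean (κ a) :=
  (I.hasSum_mean_bind μ κ).unique (hasSum_fintype _)

theorem le_mean_bind {α : Type} (μ : PMF α) (κ : α → PMF (Outcome n)) (c : ℝ)
    (h : ∀ a ∈ μ.support, c ≤ I.mean (κ a)) : c ≤ I.mean (μ.bind κ) := by
  have h1 : HasSum (fun a => (μ a).toReal) 1 := by
    have := (ENNReal.summable_toReal μ.tsum_coe_ne_top).hasSum
    rwa [← ENNReal.tsum_toReal_eq (fun a => μ.apply_ne_top a), μ.tsum_coe,
      ENNReal.toReal_one] at this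
  have h2 := h1.mul_right c
  rw [one_mul] at h2
  refine hasSum_le (fun a => ?_) h2 (I.hasSum_mean_bind μ κ)
  by_cases ha : a ∈ μ.support
  · exact mul_le_mul_of_nonneg_left (h a ha) ENNReal.toReal_nonneg
  · simp [(μ.apply_eq_zero_iff a).2 ha]

theorem mean_mix (p : unitInterval) (μ ν : PMF (Outcome n)) :
    I.mean (mix p μ ν) = p * I.mean μ + (1 - p) * I.mean ν := by
  rw [mix, mean_bind_fintype]
  simp [MeasureTheory.Measure.toPMF_apply]

theorem mean_bind_fairBinomial (κ : ℕ → PMF (Outcome n)) (m : ℕ) :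
    I.mean ((fairBinomial m).bind κ) =
      ∑ k ∈ Finset.range (m + 1), (m.choose k : ℝ) / 2 ^ m * I.mean (κ k) := by
  have hk : ∀ k, k ≤ m → (fairBinomial m k).toReal = (m.choose k : ℝ) / 2 ^ m := by
    intro k hk
    rw [fairBinomial, MeasureTheory.Measure.toPMF_apply]
    change (ProbabilityTheory.binomial m _).real {k} = _
    rw [ProbabilityTheory.binomial_real_singleton]
    have : (1 - 1 / 2 : ℝ) = 1 / 2 := by norm_num
    simp only [this]
    rw [mul_assoc, ← pow_add, Nat.add_sub_cancel' hk]
    simp [div_eq_mul_inv]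
  have hk' : ∀ k, ¬ k ≤ m → (fairBinomial m k).toReal = 0 := by
    intro k hk
    rw [fairBinomial, MeasureTheory.Measure.toPMF_apply]
    change (ProbabilityTheory.binomial m _).real {k} = _
    rw [ProbabilityTheory.binomial_real_singleton, Nat.choose_eq_zero_of_lt (by omega)]
    simp
  refine (I.hasSum_mean_bind _ κ).unique ?_
  have : ∑ k ∈ Finset.range (m + 1), (m.choose k : ℝ) / 2 ^ m * I.mean (κ k) =
      ∑ k ∈ Finset.range (m + 1), (fairBinomial m k).toReal * I.mean (κ k) :=
    Finset.sum_congr rfl fun k h => by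
      rw [hk k (Nat.lt_succ_iff.1 (Finset.mem_range.1 h))]
  rw [this]
  apply hasSum_sum_of_ne_finset_zero
  intro k h
  rw [hk' k (by simpa using h), zero_mul]

theorem mean_twoSolutions (t : ℝ) (l : List (Fin n)) :
    I.mean (I.twoSolutions t l) =
      (I.value ((I.runPricing t l).sol 0) + I.value ((I.runPricing t l).sol 1)) / 2 := by
  rw [twoSolutions, ← PMF.bind_pure_comp, mean_bind_fintype]
  simp [mean_pure]
  ring

theorem expectedValue_eq (M : List (Fin n) → PMF (Outcome n)) :
    I.expectedValue M = (∑ π : Equiv.Perm (Fin n), I.mean (M (List.ofFn π))) / n.factorial := by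
  have : I.expectedValue M =
      I.mean ((PMF.uniformOfFintype (Equiv.Perm (Fin n))).bind fun π => M (List.ofFn π)) := by
    simp only [expectedValue, mean, PMF.map_bind]
  rw [this, mean_bind_fintype]
  simp [Fintype.card_perm, ← Finset.mul_sum]
  ring

end Instance
end BudgetFeasible

/-! ### Submodularity and the posted-price procedure -/

namespace BudgetFeasible
namespace Instance

variable {n : ℕ} (I : Instance n)

theorem marginal_anti {S T : Finset (Fin n)} {i : Fin n} (h : S ⊆ T) (hi : i ∉ T) :
    I.marginal i T ≤ I.marginal i S :=
  I.submodular S T i h hi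

theorem marginal_le_singleton {S : Finset (Fin n)} {i : Fin n} (hi : i ∉ S) :
    I.marginal i S ≤ I.value {i} := by
  have := I.marginal_anti (Finset.empty_subset S) hi
  simpa [marginal, I.value_empty] using this

theorem value_insert_eq (i : Fin n) (S : Finset (Fin n)) :
    I.value (insert i S) = I.value S + I.marginal i S := by
  simp [marginal]

theorem value_union_le (A X : Finset (Fin n)) (h : Disjoint A X) :
    I.value (A ∪ X) ≤ I.value A + ∑ i ∈ X, I.marginal i A := by
  induction X using Finset.induction_on with
  | empty => simp
  | insert a X ha ih =>
    rw [Finset.disjoint_insert_right] at h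
    rw [Finset.union_insert, value_insert_eq, Finset.sum_insert ha]
    have := I.marginal_anti (i := a) (Finset.subset_union_left (s₁ := A) (s₂ := X))
      (by simp [h.1, ha])
    linarith [ih h.2]

theorem value_union_sub_le {A A' X : Finset (Fin n)} (h : A ⊆ A') (hX : Disjoint A' X) :
    I.value (A' ∪ X) - I.value A' ≤ I.value (A ∪ X) - I.value A := by
  induction X using Finset.induction_on with
  | empty => simp
  | insert a X ha ih =>
    rw [Finset.disjoint_insert_right] at hX
    rw [Finset.union_insert, Finset.union_insert, value_insert_eq, value_insert_eq]
    have := I.marginal_anti (i := a) (Finset.union_subset_union_left (t := X) h)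
      (by simp [hX.1, ha])
    linarith [ih hX.2]

/-- Adding two disjoint sets to `O` costs at most the value of `O` in total. -/
theorem value_le_value_union_add (O S T : Finset (Fin n)) (h : Disjoint S T) :
    I.value O ≤ I.value (S ∪ O) + I.value (T ∪ O) := by
  have h1 : Disjoint (T ∪ O) (S \ O) := by
    rw [Finset.disjoint_union_left]
    exact ⟨h.symm.mono_right Finset.sdiff_subset, Finset.disjoint_sdiff⟩
  have h2 := I.value_union_sub_le (A := O) (A' := T ∪ O) Finset.subset_union_right h1
  have h3 : O ∪ S \ O = S ∪ O := by rw [Finset.union_sdiff_self_eq_union, Finset.union_comm]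
  rw [h3] at h2
  linarith [I.value_nonneg (T ∪ O ∪ S \ O)]

/-- What is known about the state of the posted-price procedure with threshold `t` after the
agents of the list `l` have arrived. -/
structure PricingInvariant (t : ℝ) (l : List (Fin n)) (s : PricingState n) : Prop where
  sol_subset : ∀ j, s.sol j ⊆ l.toFinset
  disjoint : Disjoint (s.sol 0) (s.sol 1)
  remaining_eq : ∀ j, s.remaining j = I.budget - I.budget / t * I.value (s.sol j)
  cross : ∀ j k, j ≠ k → ∀ T ⊆ s.sol j, ∑ i ∈ T, I.marginal i (s.sol k) ≤ I.value (s.sol j)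
  rejected : (∃ j, ∃ i ∈ l, t - I.value {i} < I.value (s.sol j)) ∨
    ∀ i ∈ l, (∀ j, i ∉ s.sol j) → ∀ j, I.marginal i (s.sol j) ≤ t * (I.cost i / I.budget)

/-- Hiring raises the value of the growing solution by exactly the marginal that is priced, and by
submodularity it only lowers the marginals of outsiders. A refusal is due either to the budget or to
the price, which are the two alternatives of `rejected`. -/
theorem PricingInvariant.step {I : Instance n} {t : ℝ} (ht : 0 < t) {l : List (Fin n)}
    {s : PricingState n} (hs : I.PricingInvariant t l s) {i : Fin n} (hi : i ∉ l) :
    I.PricingInvariant t (l ++ [i]) (I.pricingStep t s i) := by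
  have hB := I.budget_pos
  have hout : ∀ j, i ∉ s.sol j := fun j h => hi (List.mem_toFinset.1 (hs.sol_subset j h))
  obtain ⟨j, hj, hmax⟩ : ∃ j : Fin 2,
      j = (if I.marginal i (s.sol 1) ≤ I.marginal i (s.sol 0) then 0 else 1) ∧
      ∀ k, I.marginal i (s.sol k) ≤ I.marginal i (s.sol j) := by
    refine ⟨_, rfl, fun k => ?_⟩
    split_ifs with h <;> fin_cases k <;> simp at h ⊢ <;> linarith
  set m := I.marginal i (s.sol j) with hm
  have hstep : I.pricingStep t s i =
      if I.cost i ≤ I.budget / t * m ∧ 0 ≤ s.remaining j - I.budget / t * m then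
      { sol := Function.update s.sol j (insert i (s.sol j))
        remaining := Function.update s.remaining j (s.remaining j - I.budget / t * m)
        price := Function.update s.price i (I.budget / t * m) }
      else s := by
    simp only [pricingStep, ← hj, hm]
  have hsub : l.toFinset ⊆ (l ++ [i]).toFinset := by
    intro x; simp +contextual
  rw [hstep]
  split_ifs with hc
  -- Costs are positive, so an accepted price, and with it the marginal, is positive. The solutions
  -- therefore never lose value, even though `v` is not monotone.
  · have hmpos : 0 < m := by
      have h1 : 0 < I.budget / t * m := (I.cost_pos i).trans_le hc.1
      exact (pos_iff_pos_of_mul_pos h1).1 (div_pos hB ht)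
    have hval : I.value (insert i (s.sol j)) = I.value (s.sol j) + m := I.value_insert_eq _ _
    have hmono : ∀ k, I.value (s.sol k) ≤
        I.value (Function.update s.sol j (insert i (s.sol j)) k) := by
      intro k
      rcases eq_or_ne k j with rfl | hk
      · simp [hval, hmpos.le]
      · simp [hk]
    have hsup : ∀ k, s.sol k ⊆ Function.update s.sol j (insert i (s.sol j)) k := by
      intro k
      rcases eq_or_ne k j with rfl | hk
      · simp
      · simp [hk]
    refine ⟨fun k => ?_, ?_, fun k => ?_, fun k k' hkk T hT => ?_, ?_⟩
    · rcases eq_or_ne k j with rfl | hk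
      · simp only [Function.update_self]
        exact Finset.insert_subset (by simp) ((hs.sol_subset k).trans hsub)
      · simp only [Function.update_of_ne hk]
        exact (hs.sol_subset k).trans hsub
    · have h0 := hout 0
      have h1 := hout 1
      have := hs.disjoint
      clear_value m
      clear hj hstep
      fin_cases j <;> simp [Function.update, this, h0, h1]
    · rcases eq_or_ne k j with rfl | hk
      · simp only [Function.update_self, hval, hs.remaining_eq]
        ring
      · simp only [Function.update_of_ne hk, hs.remaining_eq]
    · rcases eq_or_ne k j with rfl | hk
      · simp only [Function.update_self, Function.update_of_ne hkk.symm, hval] at hT ⊢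
        -- The newcomer's marginal to the other solution is at most `m`, which is exactly what the
        -- right-hand side gains.
        have h1 := hs.cross k k' hkk (T.erase i) (by rwa [← Finset.subset_insert_iff])
        by_cases hiT : i ∈ T
        · rw [← Finset.add_sum_erase _ _ hiT]
          linarith [hmax k']
        · rw [Finset.erase_eq_of_notMem hiT] at h1
          linarith
      · simp only [Function.update_of_ne hk] at hT ⊢
        refine le_trans (Finset.sum_le_sum fun x hx => ?_) (hs.cross k k' hkk T hT)
        have hxi : x ≠ i := fun h => hout k (h ▸ hT hx)
        have hdis : Disjoint (s.sol k) (s.sol k') := by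
          have := hs.disjoint
          clear_value m
          clear hj hstep
          fin_cases k <;> fin_cases k' <;> simp_all [disjoint_comm]
        have hxk : x ∉ s.sol k' := Finset.disjoint_left.1 hdis (hT hx)
        refine I.marginal_anti (hsup k') ?_
        rcases eq_or_ne k' j with rfl | hk'
        · simp [hxi, hxk]
        · simp [hk', hxk]
    · rcases hs.rejected with ⟨k, x, hx, h⟩ | h
      · exact Or.inl ⟨k, x, by simp [hx], h.trans_le (hmono k)⟩
      · refine Or.inr fun x hx hxs k => ?_
        have hxj := hxs j
        simp only [Function.update_self, Finset.mem_insert, not_or] at hxj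
        have hxl : x ∈ l := by simpa [hxj.1] using hx
        have hxs' : ∀ k, x ∉ s.sol k := fun k hk => hxs k (hsup k hk)
        exact (I.marginal_anti (hsup k) (hxs k)).trans (h x hxl hxs' k)
  · refine ⟨fun k => (hs.sol_subset k).trans hsub, hs.disjoint, hs.remaining_eq, hs.cross, ?_⟩
    rcases hs.rejected with ⟨k, x, hx, h⟩ | h
    · exact Or.inl ⟨k, x, by simp [hx], h⟩
    · by_cases hcost : I.cost i ≤ I.budget / t * m
      · left
        -- By `remaining_eq` an overdrawn budget means `t < v(S_j) + m`, and `m` is at most the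
        -- singleton value.
        have hrem : s.remaining j - I.budget / t * m < 0 := not_le.1 fun h => hc ⟨hcost, h⟩
        refine ⟨j, i, by simp, ?_⟩
        rw [hs.remaining_eq] at hrem
        have h1 : I.budget / t * (t - I.value (s.sol j) - m) < 0 := by
          have : I.budget / t * t = I.budget := by field_simp
          linarith
        have h2 := neg_of_mul_neg_right h1 (div_pos hB ht).le
        have h3 : m ≤ I.value {i} := I.marginal_le_singleton (hout j)
        linarith
      · refine Or.inr fun x hx hxs k => ?_
        rcases List.mem_append.1 hx with hxl | hxi
        · exact h x hxl hxs k
        · obtain rfl : x = i := by simpa using hxi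
          refine (hmax k).trans ?_
          have h1 : t / I.budget * (I.budget / t * m) ≤ t / I.budget * I.cost x :=
            mul_le_mul_of_nonneg_left (not_le.1 hcost).le (div_pos ht hB).le
          have h2 : t / I.budget * (I.budget / t * m) = m := by field_simp
          rw [h2] at h1
          calc m ≤ _ := h1
            _ = _ := by ring

theorem pricingInvariant_runPricing {t : ℝ} (ht : 0 < t) {l : List (Fin n)} (hl : l.Nodup) :
    I.PricingInvariant t l (I.runPricing t l) := by
  induction l using List.reverseRecOn with
  | nil =>
    refine ⟨by simp [runPricing], by simp [runPricing], by simp [runPricing, I.value_empty],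
      fun j k _ T hT => ?_, by simp⟩
    obtain rfl : T = ∅ := by simpa [runPricing] using hT
    simp [runPricing, I.value_empty]
  | append_singleton l i ih =>
    rw [List.nodup_append] at hl
    have := (ih hl.1).step ht (i := i) fun h => hl.2.2 i h i (by simp) rfl
    simpa [runPricing] using this

/-- Either some budget is nearly exhausted, or the two solutions compete with every feasible
set of arriving agents. -/
theorem runPricing_guarantee {t θ : ℝ} (ht : 0 < t) {l : List (Fin n)} (hl : l.Nodup)
    (hθ : ∀ i ∈ l, I.value {i} ≤ θ) {O : Finset (Fin n)} (hO : O ⊆ l.toFinset)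
    (hfeas : I.Feasible O) :
    t - θ ≤ I.value ((I.runPricing t l).sol 0) + I.value ((I.runPricing t l).sol 1) ∨
    I.value O ≤
      2 * (I.value ((I.runPricing t l).sol 0) + I.value ((I.runPricing t l).sol 1)) + 2 * t := by
  have hs := I.pricingInvariant_runPricing ht hl
  set s := I.runPricing t l
  have hB := I.budget_pos
  have h0 := I.value_nonneg (s.sol 0)
  have h1 := I.value_nonneg (s.sol 1)
  rcases hs.rejected with ⟨j, i, hi, h⟩ | h
  · left
    have := hθ i hi
    fin_cases j <;> simp at h <;> linarith
  · right
    have key : ∀ j k, j ≠ k → I.value (s.sol j ∪ O) ≤ I.value (s.sol j) + I.value (s.sol k) + t := by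
      intro j k hjk
      have hu : s.sol j ∪ O = s.sol j ∪ O \ s.sol j := by simp
      rw [hu]
      refine (I.value_union_le _ _ Finset.disjoint_sdiff).trans ?_
      -- Members of `O` in the other solution are charged to its value by `cross`; those in neither
      -- are charged to their costs, in total at most `t`.
      rw [← Finset.sum_filter_add_sum_filter_not (O \ s.sol j) (fun i => i ∈ s.sol k)]
      have e1 := hs.cross k j hjk.symm ((O \ s.sol j).filter fun i => i ∈ s.sol k)
        fun x hx => (Finset.mem_filter.1 hx).2
      have e2 : ∑ i ∈ (O \ s.sol j).filter (fun i => i ∉ s.sol k), I.marginal i (s.sol j) ≤ t := by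
        have hout : ∀ x, x ∉ s.sol j → x ∉ s.sol k → ∀ m, x ∉ s.sol m := by
          intro x hx hx' m
          fin_cases j <;> fin_cases k <;> fin_cases m <;> simp_all
        calc ∑ i ∈ (O \ s.sol j).filter (fun i => i ∉ s.sol k), I.marginal i (s.sol j)
            ≤ ∑ i ∈ (O \ s.sol j).filter (fun i => i ∉ s.sol k), t * (I.cost i / I.budget) := by
              refine Finset.sum_le_sum fun x hx => ?_
              simp only [Finset.mem_filter, Finset.mem_sdiff] at hx
              exact h x (List.mem_toFinset.1 (hO hx.1.1)) (hout x hx.1.2 hx.2) j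
          _ ≤ ∑ i ∈ O, t * (I.cost i / I.budget) := by
              refine Finset.sum_le_sum_of_subset_of_nonneg
                ((Finset.filter_subset _ _).trans Finset.sdiff_subset) fun x _ _ => ?_
              have := I.cost_pos x
              positivity
          _ = t * ((∑ i ∈ O, I.cost i) / I.budget) := by
              rw [← Finset.mul_sum, Finset.sum_div]
          _ ≤ t * 1 := by
              refine mul_le_mul_of_nonneg_left ?_ ht.le
              rw [div_le_one hB]
              exact hfeas
          _ = t := mul_one t
      linarith
    have a := key 0 1 (by simp)
    have b := key 1 0 (by simp)
    linarith [I.value_le_value_union_add O _ _ hs.disjoint]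

end Instance
end BudgetFeasible

/-! ### Random samples, concentration, and weights on the optimum -/

namespace BudgetFeasible

/-- The first `k` agents of a uniformly random order form a uniformly random `k`-set. -/
theorem card_perm_take_eq {n k : ℕ} (hk : k ≤ n) {X : Finset (Fin n)} (hX : X.card = k) :
    n.choose k * (Finset.univ.filter fun π : Equiv.Perm (Fin n) =>
      ((List.ofFn π).take k).toFinset = X).card = n.factorial := by
  classical
  have hcard : ∀ π : Equiv.Perm (Fin n), ((List.ofFn π).take k).toFinset.card = k := by
    intro π
    rw [List.toFinset_card_of_nodup, List.length_take, List.length_ofFn, min_eq_left hk]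
    exact (List.nodup_ofFn.2 π.injective).sublist (List.take_sublist _ _)
  have hsymm : ∀ Y ∈ Finset.univ.powersetCard k,
      (Finset.univ.filter fun π : Equiv.Perm (Fin n) =>
        ((List.ofFn π).take k).toFinset = Y).card =
      (Finset.univ.filter fun π : Equiv.Perm (Fin n) =>
        ((List.ofFn π).take k).toFinset = X).card := by
    intro Y hY
    have hY' : Y.card = X.card := by rw [hX]; exact (Finset.mem_powersetCard.1 hY).2
    -- A permutation `σ` carrying `Y` onto `X` relabels the agents; left multiplication by it
    -- matches the two fibres, so all `k`-sets are equally likely.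
    let e : {x // x ∈ Y} ≃ {x // x ∈ X} := Finset.equivOfCardEq hY'
    let σ : Equiv.Perm (Fin n) := e.extendSubtype
    have hσ : Y.image σ = X := by
      apply Finset.eq_of_subset_of_card_le
      · intro x hx
        obtain ⟨y, hy, rfl⟩ := Finset.mem_image.1 hx
        exact e.extendSubtype_mem y hy
      · rw [Finset.card_image_of_injective _ σ.injective, hY']
    have himg : ∀ π : Equiv.Perm (Fin n), ((List.ofFn (σ * π)).take k).toFinset =
        ((List.ofFn π).take k).toFinset.image σ := by
      intro π
      ext x
      have : List.ofFn (σ * π) = (List.ofFn π).map σ := by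
        rw [List.map_ofFn]; rfl
      rw [this, ← List.map_take]
      simp only [List.mem_toFinset, List.mem_map, Finset.mem_image]
    refine Finset.card_bij (fun π _ => σ * π) ?_ (fun _ _ _ _ h => mul_left_cancel h) ?_
    · intro π hπ
      simp only [Finset.mem_filter, Finset.mem_univ, true_and] at hπ ⊢
      rw [himg, hπ, hσ]
    · intro π hπ
      refine ⟨σ⁻¹ * π, ?_, by simp⟩
      simp only [Finset.mem_filter, Finset.mem_univ, true_and] at hπ ⊢
      apply Finset.image_injective σ.injective
      rw [← himg, mul_inv_cancel_left, hπ]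
      exact hσ.symm
  have htot := Finset.card_eq_sum_card_fiberwise
    (s := (Finset.univ : Finset (Equiv.Perm (Fin n))))
    (t := Finset.univ.powersetCard k) (f := fun π : Equiv.Perm (Fin n) => ((List.ofFn π).take k).toFinset)
    (fun π _ => Finset.mem_coe.2 (Finset.mem_powersetCard.2 ⟨Finset.subset_univ _, hcard π⟩))
  rw [Finset.sum_congr rfl hsymm, Finset.sum_const, Finset.card_powersetCard] at htot
  simpa [Fintype.card_perm] using htot.symm

/-- The first `ξ` agents of a uniformly random order, for a fair binomial `ξ`, form a uniformly
random set. -/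
theorem sum_choose_mul_sum_perm_take {n : ℕ} (h : Finset (Fin n) → ℝ) :
    ∑ k ∈ Finset.range (n + 1), (n.choose k : ℝ) / 2 ^ n *
      ∑ π : Equiv.Perm (Fin n), h ((List.ofFn π).take k).toFinset =
    n.factorial * ((∑ X, h X) / 2 ^ n) := by
  classical
  have hlayer : ∀ k ∈ Finset.range (n + 1), (n.choose k : ℝ) / 2 ^ n *
      ∑ π : Equiv.Perm (Fin n), h ((List.ofFn π).take k).toFinset =
      n.factorial / 2 ^ n * ∑ X ∈ Finset.univ.powersetCard k, h X := by
    intro k hk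
    have hk : k ≤ n := Nat.lt_succ_iff.1 (Finset.mem_range.1 hk)
    have hmaps : ∀ π ∈ (Finset.univ : Finset (Equiv.Perm (Fin n))),
        ((List.ofFn π).take k).toFinset ∈ Finset.univ.powersetCard k := by
      intro π _
      refine Finset.mem_powersetCard.2 ⟨Finset.subset_univ _, ?_⟩
      rw [List.toFinset_card_of_nodup, List.length_take, List.length_ofFn, min_eq_left hk]
      exact (List.nodup_ofFn.2 π.injective).sublist (List.take_sublist _ _)
    rw [← Finset.sum_fiberwise_of_maps_to hmaps, Finset.mul_sum, Finset.mul_sum]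
    refine Finset.sum_congr rfl fun X hX => ?_
    rw [Finset.sum_congr rfl (g := fun _ => h X)
      (fun π hπ => by rw [(Finset.mem_filter.1 hπ).2]), Finset.sum_const, nsmul_eq_mul]
    have := card_perm_take_eq hk (Finset.mem_powersetCard.1 hX).2
    rw [← this]
    push_cast
    ring
  rw [Finset.sum_congr rfl hlayer, ← Finset.mul_sum]
  have := Finset.sum_powerset (Finset.univ : Finset (Fin n)) h
  rw [Finset.powerset_univ, Finset.card_univ, Fintype.card_fin] at this
  rw [this]
  ring

/-- One-sided Hoeffding inequality for a uniformly random subset. -/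
theorem card_filter_hoeffding {ι : Type*} [Fintype ι] [DecidableEq ι] (w : ι → ℝ) {s b : ℝ}
    (hb : 0 < b) (hw : ∑ i, w i ^ 2 ≤ b) (hs : 0 ≤ s) :
    ((Finset.univ.filter fun X : Finset ι => s < ∑ i ∈ X, w i - ∑ i ∈ Xᶜ, w i).card : ℝ) ≤
      2 ^ Fintype.card ι * Real.exp (-(s ^ 2 / (2 * b))) := by
  -- This is the minimiser of the Chernoff exponent `c ^ 2 * b / 2 - c * s`.
  set c := s / b with hc
  have hc0 : 0 ≤ c := div_nonneg hs hb.le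
  have hprod : ∑ X : Finset ι, Real.exp (c * (∑ i ∈ X, w i - ∑ i ∈ Xᶜ, w i)) ≤
      2 ^ Fintype.card ι * Real.exp (c ^ 2 * b / 2) := by
    -- Membership in `X` acts as independent fair signs, so the moment generating function factors;
    -- each factor is `2 cosh (c * w i)`.
    have h1 : ∑ X : Finset ι, Real.exp (c * (∑ i ∈ X, w i - ∑ i ∈ Xᶜ, w i)) =
        ∏ i, (Real.exp (c * w i) + Real.exp (-(c * w i))) := by
      rw [Finset.prod_add, Finset.powerset_univ]
      refine Finset.sum_congr rfl fun X _ => ?_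
      rw [← Real.exp_sum, ← Real.exp_sum, ← Real.exp_add, ← Finset.compl_eq_univ_sdiff]
      rw [Finset.sum_neg_distrib, ← Finset.mul_sum, ← Finset.mul_sum]
      ring_nf
    rw [h1]
    have h2 : ∀ i, Real.exp (c * w i) + Real.exp (-(c * w i)) ≤
        2 * Real.exp ((c * w i) ^ 2 / 2) := by
      intro i
      have := Real.cosh_le_exp_half_sq (c * w i)
      rw [Real.cosh_eq] at this
      linarith
    refine (Finset.prod_le_prod (fun i _ => by positivity) fun i _ => h2 i).trans ?_
    rw [Finset.prod_mul_distrib, Finset.prod_const, Finset.card_univ, ← Real.exp_sum]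
    refine mul_le_mul_of_nonneg_left (Real.exp_le_exp.2 ?_) (by positivity)
    have : ∑ i, (c * w i) ^ 2 / 2 = c ^ 2 * (∑ i, w i ^ 2) / 2 := by
      rw [Finset.mul_sum, Finset.sum_div]
      exact Finset.sum_congr rfl fun i _ => by ring
    rw [this]
    have := mul_le_mul_of_nonneg_left hw (sq_nonneg c)
    linarith
  have hmarkov :
      ((Finset.univ.filter fun X : Finset ι => s < ∑ i ∈ X, w i - ∑ i ∈ Xᶜ, w i).card : ℝ) *
        Real.exp (c * s) ≤
      ∑ X : Finset ι, Real.exp (c * (∑ i ∈ X, w i - ∑ i ∈ Xᶜ, w i)) := by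
    rw [← nsmul_eq_mul, ← Finset.sum_const]
    refine (Finset.sum_le_sum fun X hX => ?_).trans
      (Finset.sum_le_sum_of_subset_of_nonneg (Finset.filter_subset _ _)
        fun _ _ _ => (Real.exp_pos _).le)
    exact Real.exp_le_exp.2
      (mul_le_mul_of_nonneg_left (Finset.mem_filter.1 hX).2.le hc0)
  have h3 := hmarkov.trans hprod
  rw [← le_div_iff₀ (Real.exp_pos _), mul_div_assoc, ← Real.exp_sub] at h3
  have h4 : c ^ 2 * b / 2 - c * s = -(s ^ 2 / (2 * b)) := by
    rw [hc]
    field_simp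
    ring
  rwa [h4] at h3

/-- With high probability, both a uniformly random set and its complement carry almost half of
the total weight. -/
theorem card_filter_halves {ι : Type*} [Fintype ι] [DecidableEq ι] (w : ι → ℝ) {V θ δ : ℝ}
    (hw0 : ∀ i, 0 ≤ w i) (hwθ : ∀ i, w i ≤ θ) (hV : ∑ i, w i = V) (hV0 : 0 < V) (hθ : 0 < θ)
    (hδ : 0 ≤ δ) :
    2 ^ Fintype.card ι * (1 - 2 * Real.exp (-(2 * δ ^ 2 * V / θ))) ≤
    ((Finset.univ.filter fun X : Finset ι =>
      (1 / 2 - δ) * V ≤ ∑ i ∈ X, w i ∧ (1 / 2 - δ) * V ≤ ∑ i ∈ Xᶜ, w i).card : ℝ) := by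
  have hsq : ∑ i, w i ^ 2 ≤ θ * V := by
    rw [← hV, Finset.mul_sum]
    refine Finset.sum_le_sum fun i _ => ?_
    rw [sq]
    exact mul_le_mul_of_nonneg_right (hwθ i) (hw0 i)
  -- Since the two sides sum to `V`, one of them is below `(1 / 2 - δ) * V` exactly when they differ
  -- by more than `2 * δ * V`.
  have hs : 0 ≤ 2 * δ * V := by positivity
  have hexp : (2 * δ * V) ^ 2 / (2 * (θ * V)) = 2 * δ ^ 2 * V / θ := by
    field_simp
  have h1 := card_filter_hoeffding w (mul_pos hθ hV0) hsq hs
  have h2 := card_filter_hoeffding (fun i => -w i) (mul_pos hθ hV0) (by simpa using hsq) hs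
  rw [hexp] at h1 h2
  have hsplit : ∀ X : Finset ι, ∑ i ∈ X, w i + ∑ i ∈ Xᶜ, w i = V := fun X => by
    rw [Finset.sum_add_sum_compl, hV]
  have hcover : (Finset.univ : Finset (Finset ι)) ⊆
      (Finset.univ.filter fun X : Finset ι =>
        (1 / 2 - δ) * V ≤ ∑ i ∈ X, w i ∧ (1 / 2 - δ) * V ≤ ∑ i ∈ Xᶜ, w i) ∪
      ((Finset.univ.filter fun X : Finset ι => 2 * δ * V < ∑ i ∈ X, w i - ∑ i ∈ Xᶜ, w i) ∪
      (Finset.univ.filter fun X : Finset ι => 2 * δ * V < ∑ i ∈ X, -w i - ∑ i ∈ Xᶜ, -w i)) := by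
    intro X _
    simp only [Finset.mem_union, Finset.mem_filter, Finset.mem_univ, true_and,
      Finset.sum_neg_distrib]
    have := hsplit X
    by_contra! hX
    obtain ⟨a, b, c⟩ := hX
    exact absurd (a (by linarith)) (by linarith)
  have hcard := (Finset.card_le_card hcover).trans
    ((Finset.card_union_le _ _).trans (Nat.add_le_add_left (Finset.card_union_le _ _) _))
  rw [Finset.card_univ, Fintype.card_finset] at hcard
  have hcard' : ((2 ^ Fintype.card ι : ℕ) : ℝ) ≤ _ := Nat.cast_le.2 hcard
  push_cast at hcard'
  linarith

namespace Instance

variable {n : ℕ} (I : Instance n)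

/-- The weights are the marginals of the members of `O` when `O` is built up in label order.
Restricting to a subset of `O` shrinks the predecessor sets, so its true marginals are at least
these weights. They let additive concentration control the submodular value. -/
theorem exists_weights {O : Finset (Fin n)} (hO : I.IsOptimal O) :
    ∃ w : Fin n → ℝ, (∀ i, 0 ≤ w i) ∧ (∀ i, w i ≤ I.value {i}) ∧ ∑ i, w i = I.value O ∧
      ∀ X, ∑ i ∈ X, w i ≤ I.value (O ∩ X) := by
  have hsum : ∀ A : Finset (Fin n),
      ∑ i ∈ A, I.marginal i (A.filter (· < i)) = I.value A := by
    intro A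
    induction A using Finset.induction_on_max with
    | empty => simp [I.value_empty]
    | insert a s ha ih =>
      have has : a ∉ s := fun h => lt_irrefl _ (ha a h)
      rw [Finset.sum_insert has]
      have h1 : (insert a s).filter (· < a) = s := by
        rw [Finset.filter_insert, if_neg (lt_irrefl a)]
        exact Finset.filter_true_of_mem ha
      have h2 : ∀ i ∈ s, (insert a s).filter (· < i) = s.filter (· < i) := by
        intro i hi
        rw [Finset.filter_insert, if_neg (ha i hi).not_gt]
      rw [h1, Finset.sum_congr rfl fun i hi => by rw [h2 i hi], ih, marginal]
      ring
  have hpart : ∀ A ⊆ O, ∑ i ∈ A, I.marginal i (O.filter (· < i)) ≤ I.value A := by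
    intro A hA
    rw [← hsum A]
    refine Finset.sum_le_sum fun i _ => I.submodular _ _ _ ?_ (by simp)
    exact Finset.filter_subset_filter _ hA
  have hfilter : ∀ X : Finset (Fin n),
      ∑ i ∈ X, (if i ∈ O then I.marginal i (O.filter (· < i)) else 0) =
      ∑ i ∈ O ∩ X, I.marginal i (O.filter (· < i)) := by
    intro X
    rw [← Finset.sum_filter, Finset.filter_mem_eq_inter, Finset.inter_comm]
  refine ⟨fun i => if i ∈ O then I.marginal i (O.filter (· < i)) else 0, ?_, ?_, ?_, ?_⟩
  · intro i
    dsimp only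
    split_ifs with hi
    -- Nonnegativity comes from optimality: removing an agent keeps feasibility, so her marginal to
    -- the rest of `O` is nonnegative, and her weight is at least that.
    · have h1 : I.value (O.erase i) ≤ I.value O := by
        refine hO.2 _ ((Finset.sum_le_sum_of_subset_of_nonneg (Finset.erase_subset _ _)
          fun x _ _ => (I.cost_pos x).le).trans hO.1)
      have h2 := I.submodular (O.filter (· < i)) (O.erase i) i
        (fun x hx => by
          rw [Finset.mem_filter] at hx
          exact Finset.mem_erase.2 ⟨hx.2.ne, hx.1⟩) (by simp)
      rw [Finset.insert_erase hi] at h2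
      simp only [marginal]
      linarith
    · exact le_rfl
  · intro i
    dsimp only
    split_ifs with hi
    · have := I.submodular ∅ (O.filter (· < i)) i (Finset.empty_subset _) (by simp)
      simpa [marginal, I.value_empty] using this
    · exact I.value_nonneg _
  · rw [hfilter, Finset.inter_univ, hsum]
  · intro X
    rw [hfilter]
    exact hpart _ Finset.inter_subset_left

end Instance
end BudgetFeasible

/-! ### Dynkin's algorithm -/

namespace BudgetFeasible

theorem card_perm_apply_eq {n : ℕ} (k m : Fin n) :
    n * (Finset.univ.filter fun π : Equiv.Perm (Fin n) => π k = m).card = n.factorial := by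
  have hsymm : ∀ m' ∈ (Finset.univ : Finset (Fin n)),
      (Finset.univ.filter fun π : Equiv.Perm (Fin n) => π k = m').card =
      (Finset.univ.filter fun π : Equiv.Perm (Fin n) => π k = m).card := by
    intro m' _
    refine Finset.card_bij (fun π _ => Equiv.swap m m' * π) ?_
      (fun _ _ _ _ h => mul_left_cancel h) ?_
    · intro π hπ
      simp only [Finset.mem_filter, Finset.mem_univ, true_and] at hπ ⊢
      simp [hπ]
    · intro π hπ
      refine ⟨Equiv.swap m m' * π, ?_, ?_⟩
      · simp only [Finset.mem_filter, Finset.mem_univ, true_and] at hπ ⊢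
        simp [hπ]
      · rw [← mul_assoc, Equiv.swap_mul_self, one_mul]
  have htot := Finset.card_eq_sum_card_fiberwise
    (s := (Finset.univ : Finset (Equiv.Perm (Fin n)))) (t := Finset.univ)
    (f := fun π : Equiv.Perm (Fin n) => π k) (fun _ _ => Finset.mem_coe.2 (Finset.mem_univ _))
  rw [Finset.sum_congr rfl hsymm, Finset.sum_const] at htot
  simpa [Fintype.card_perm] using htot.symm

/-- The number of orders with `m` at position `k` and the best of the agents before her at
position `l`. -/
theorem card_perm_best_before {n : ℕ} {α : Type*} [LinearOrder α] {f : Fin n → α}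
    (hf : Function.Injective f) (m : Fin n) {k l : Fin n} (hl : l < k) :
    n * (k * (Finset.univ.filter fun π : Equiv.Perm (Fin n) =>
      π k = m ∧ ∀ j < k, f (π j) ≤ f (π l)).card) = n.factorial := by
  classical
  set A : Fin n → Finset (Equiv.Perm (Fin n)) := fun l =>
    Finset.univ.filter fun π => π k = m ∧ ∀ j < k, f (π j) ≤ f (π l) with hA
  -- Swapping two positions before `k` keeps `m` in place and moves the best predecessor, so all `k`
  -- positions are equally frequent.
  have hsub : ∀ l₁ l₂, l₁ < k → l₂ < k → ∀ π ∈ A l₁, π * Equiv.swap l₁ l₂ ∈ A l₂ := by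
    intro l₁ l₂ h₁ h₂ π hπ
    simp only [hA, Finset.mem_filter, Finset.mem_univ, true_and, Equiv.Perm.mul_apply] at hπ ⊢
    rw [Equiv.swap_apply_of_ne_of_ne h₁.ne' h₂.ne', Equiv.swap_apply_right]
    refine ⟨hπ.1, fun j hj => hπ.2 _ ?_⟩
    rw [Equiv.swap_apply_def]
    split_ifs <;> assumption
  have hsymm : ∀ l' ∈ Finset.Iio k, (A l').card = (A l).card := by
    intro l' hl'
    have hl' := Finset.mem_Iio.1 hl'
    refine Finset.card_bij (fun π _ => π * Equiv.swap l' l) (hsub l' l hl' hl)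
      (fun _ _ _ _ h => mul_right_cancel h) fun π hπ => ⟨π * Equiv.swap l l', ?_, ?_⟩
    · exact hsub l l' hl hl' π hπ
    · rw [Equiv.swap_comm l' l, mul_assoc, Equiv.swap_mul_self, mul_one]
  have hunion : (Finset.Iio k).biUnion A =
      Finset.univ.filter fun π : Equiv.Perm (Fin n) => π k = m := by
    ext π
    simp only [hA, Finset.mem_biUnion, Finset.mem_Iio, Finset.mem_filter, Finset.mem_univ,
      true_and]
    constructor
    · rintro ⟨_, _, h, _⟩
      exact h
    · intro h
      obtain ⟨b, hb, hmax⟩ := Finset.exists_max_image (Finset.Iio k) (fun j => f (π j))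
        ⟨l, Finset.mem_Iio.2 hl⟩
      exact ⟨b, Finset.mem_Iio.1 hb, h, fun j hj => hmax j (Finset.mem_Iio.2 hj)⟩
  have hdisj : ∀ l₁ ∈ Finset.Iio k, ∀ l₂ ∈ Finset.Iio k, l₁ ≠ l₂ → Disjoint (A l₁) (A l₂) := by
    intro l₁ h₁ l₂ h₂ hne
    rw [Finset.disjoint_left]
    intro π hπ₁ hπ₂
    simp only [hA, Finset.mem_filter, Finset.mem_univ, true_and] at hπ₁ hπ₂
    exact hne (π.injective (hf (le_antisymm (hπ₂.2 _ (Finset.mem_Iio.1 h₁))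
      (hπ₁.2 _ (Finset.mem_Iio.1 h₂)))))
  have := Finset.card_biUnion hdisj
  rw [hunion, Finset.sum_congr rfl hsymm, Finset.sum_const, Fin.card_Iio, smul_eq_mul] at this
  rw [← this, card_perm_apply_eq]

/-- The trapezoidal rule overestimates the integral of the convex function `1 / x`, and the
left-endpoint sum exceeds it by `(1 / r - 1 / n) / 2`. This correction later absorbs the rounding of
`n / e`. -/
theorem log_div_le_sum_inv {r n : ℕ} (hr : 0 < r) (hn : r ≤ n) :
    Real.log n - Real.log r + (1 / r - 1 / n) / 2 ≤ ∑ k ∈ Finset.Ico r n, (1 : ℝ) / k := by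
  induction n, hn using Nat.le_induction with
  | base => simp
  | succ k hk ih =>
    rw [Finset.sum_Ico_succ_top hk]
    have hk0 : (0 : ℝ) < k := by exact_mod_cast hr.trans_le hk
    have hlog : Real.log (k + 1) - Real.log k ≤ (1 / k + 1 / (k + 1)) / 2 := by
      rw [← Real.log_div (by positivity) hk0.ne']
      set y : ℝ := (k + 1) / k with hy
      have hy1 : 1 ≤ y := by rw [hy, le_div_iff₀ hk0]; linarith
      -- For `y = (k + 1) / k`, `log y ≤ sinh (log y) = (y - 1 / y) / 2` is the trapezoid bound.
      have := Real.self_le_sinh_iff.2 (Real.log_nonneg hy1)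
      rw [Real.sinh_eq, Real.exp_neg, Real.exp_log (by linarith)] at this
      refine this.trans (le_of_eq ?_)
      rw [hy]
      field_simp
      ring
    push_cast
    linarith

theorem floor_div_exp_one_eq {n r : ℕ} (h₁ : (r : ℝ) * 2.7182818286 ≤ n)
    (h₂ : (n : ℝ) < (r + 1) * 2.7182818283) : ⌊(n : ℝ) / Real.exp 1⌋₊ = r := by
  have e1 := Real.exp_one_gt_d9
  have e2 := Real.exp_one_lt_d9
  have e0 := Real.exp_pos 1
  rw [Nat.floor_eq_iff (by positivity), le_div_iff₀ e0, div_lt_iff₀ e0]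
  constructor
  · exact (mul_le_mul_of_nonneg_left e2.le (Nat.cast_nonneg r)).trans h₁
  · exact h₂.trans (mul_lt_mul_of_pos_left e1 (by positivity))

/-- The success probability of Dynkin's algorithm is at least `1 / e`. -/
theorem inv_exp_one_le_dynkin_sum {n : ℕ} (hn : 3 ≤ n) :
    1 / Real.exp 1 ≤ (⌊(n : ℝ) / Real.exp 1⌋₊ : ℝ) / n *
      ∑ k ∈ Finset.Ico ⌊(n : ℝ) / Real.exp 1⌋₊ n, (1 : ℝ) / k := by
  have e1 := Real.exp_one_gt_d9
  have e2 := Real.exp_one_lt_d9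
  have e0 := Real.exp_pos 1
  -- The final estimate needs `2 * e ≤ (1 - x) * n`; with `x ≤ 0.3679` this holds from `n = 9` on.
  -- Smaller `n` are computed.
  rcases lt_or_ge n 9 with hn9 | hn9
  · have he : 1 / Real.exp 1 ≤ 0.3679 := by
      rw [div_le_iff₀ e0]
      norm_num at e1 ⊢
      linarith
    refine he.trans ?_
    interval_cases n
    · rw [floor_div_exp_one_eq (r := 1) (by norm_num) (by norm_num)]
      norm_num [Finset.sum_Ico_succ_top]
    · rw [floor_div_exp_one_eq (r := 1) (by norm_num) (by norm_num)]
      norm_num [Finset.sum_Ico_succ_top]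
    · rw [floor_div_exp_one_eq (r := 1) (by norm_num) (by norm_num)]
      norm_num [Finset.sum_Ico_succ_top]
    · rw [floor_div_exp_one_eq (r := 2) (by norm_num) (by norm_num)]
      norm_num [Finset.sum_Ico_succ_top]
    · rw [floor_div_exp_one_eq (r := 2) (by norm_num) (by norm_num)]
      norm_num [Finset.sum_Ico_succ_top]
    · rw [floor_div_exp_one_eq (r := 2) (by norm_num) (by norm_num)]
      norm_num [Finset.sum_Ico_succ_top]
  · set r := ⌊(n : ℝ) / Real.exp 1⌋₊ with hr
    have hn0 : (9 : ℝ) ≤ n := by exact_mod_cast hn9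
    have hnpos : (0 : ℝ) < n := by linarith
    have hle : (r : ℝ) ≤ n / Real.exp 1 := Nat.floor_le (by positivity)
    have hlt : (n : ℝ) / Real.exp 1 < r + 1 := Nat.lt_floor_add_one _
    have hr0 : 0 < r := by
      rw [hr, Nat.floor_pos, le_div_iff₀ e0]
      linarith
    have hrpos : (0 : ℝ) < r := by exact_mod_cast hr0
    have hrn : r ≤ n := by
      have : (r : ℝ) ≤ n := hle.trans (div_le_self hnpos.le (by linarith))
      exact_mod_cast this
    have hsum := log_div_le_sum_inv hr0 hrn
    set x : ℝ := r / n with hx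
    have hxpos : 0 < x := by positivity
    have hlog : Real.log r - Real.log n ≤ Real.exp 1 * x - 2 := by
      have h := Real.log_le_sub_one_of_pos (mul_pos e0 hxpos)
      rw [Real.log_mul e0.ne' hxpos.ne', Real.log_exp, hx,
        Real.log_div hrpos.ne' hnpos.ne'] at h
      linarith
    have hmain : x * (2 - Real.exp 1 * x) + (1 - x) / (2 * n) ≤
        x * ∑ k ∈ Finset.Ico r n, (1 : ℝ) / k := by
      have h1 : x * ((1 / r - 1 / n) / 2) = (1 - x) / (2 * n) := by
        rw [hx]
        field_simp
      rw [← h1, ← mul_add]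
      exact mul_le_mul_of_nonneg_left (by linarith) hxpos.le
    refine le_trans ?_ hmain
    -- `x * (2 - e * x)` is maximal at `1 / e`, so the rounding error `d ≤ 1 / n` costs only `e * d
    -- ^ 2`, less than the gain of order `1 / n`.
    set d : ℝ := 1 / Real.exp 1 - x with hd
    have hd0 : 0 ≤ d := by
      rw [hd, hx, sub_nonneg, div_le_iff₀ hnpos]
      calc (r : ℝ) ≤ n / Real.exp 1 := hle
        _ = _ := by ring
    have hd1 : d ≤ 1 / n := by
      have : (n : ℝ) * d = n / Real.exp 1 - r := by
        rw [hd, hx]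
        field_simp
      rw [le_div_iff₀ hnpos]
      linarith
    have hxd : x = 1 / Real.exp 1 - d := by rw [hd]; ring
    have hid : x * (2 - Real.exp 1 * x) = 1 / Real.exp 1 - Real.exp 1 * d ^ 2 := by
      rw [hxd]
      field_simp
      ring
    have hd2 : Real.exp 1 * d ^ 2 ≤ Real.exp 1 * (1 / n * (1 / n)) := by
      rw [sq]
      exact mul_le_mul_of_nonneg_left (mul_le_mul hd1 hd1 hd0 (by positivity)) e0.le
    have hx1 : x ≤ 0.3679 := by
      have : 1 / Real.exp 1 ≤ 0.3679 := by
        rw [div_le_iff₀ e0]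
        norm_num at e1 ⊢
        linarith
      linarith
    have hfin : Real.exp 1 * (1 / n * (1 / n)) ≤ (1 - x) / (2 * n) := by
      rw [le_div_iff₀ (by positivity)]
      have : Real.exp 1 * (1 / n * (1 / n)) * (2 * n) = 2 * Real.exp 1 / n := by
        field_simp
      rw [this, div_le_iff₀ hnpos]
      have h3 : 9 * (1 - x) ≤ (1 - x) * n := by
        rw [mul_comm]
        exact mul_le_mul_of_nonneg_left hn0 (by linarith)
      norm_num at e2 hx1
      linarith
    linarith

namespace Instance

variable {n : ℕ} (I : Instance n)

theorem hireFirst_of_find {P : Fin n → Prop} {l : List (Fin n)} {k : ℕ} (hk : k < l.length)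
    (hP : P l[k]) (hnot : ∀ j (hj : j < k), ¬ P l[j]) :
    (I.hireFirst P l).winners = {l[k]} := by
  classical
  have : l.find? (fun j => decide (P j)) = some l[k] := by
    rw [List.find?_eq_some_iff_getElem]
    exact ⟨by simpa using hP, k, hk, rfl, fun j hj => by simpa using hnot j hj⟩
  have h2 : I.hireFirst P l = ⟨{l[k]}, Pi.single l[k] I.budget⟩ := by
    unfold hireFirst
    split
    · rename_i h
      rw [List.find?_eq_none] at h
      exact absurd hP (by simpa using h l[k] (List.getElem_mem hk))
    · rename_i j h
      have hj : some j = some l[k] := by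
        rw [← h, ← this]
      obtain rfl := Option.some.inj hj
      rfl
  rw [h2]

/-- The order in which Dynkin's algorithm compares the agents. -/
def rank (i : Fin n) : ℝ ×ₗ Fin n := toLex (I.value {i}, i)

theorem rank_injective : Function.Injective I.rank := fun _ _ h =>
  (Prod.ext_iff.1 (toLex.injective h)).2

theorem beats_iff {j i : Fin n} : I.Beats j i ↔ I.rank i ≤ I.rank j := by
  rw [rank, rank, Prod.Lex.le_iff]
  rfl

/-- If the best agent before `m` lies in the sample, nobody between the sample and `m` can beat the
whole sample, so `m` is the first to do so. -/
theorem dynkin_winners {m : Fin n} (hm : ∀ i, I.rank i ≤ I.rank m) {π : Equiv.Perm (Fin n)}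
    {k l : Fin n} (hk : ⌊(n : ℝ) / Real.exp 1⌋₊ ≤ k) (hl : (l : ℕ) < ⌊(n : ℝ) / Real.exp 1⌋₊)
    (hπ : π k = m ∧ ∀ j < k, I.rank (π j) ≤ I.rank (π l)) :
    (I.dynkin (List.ofFn π)).winners = {m} := by
  unfold dynkin
  set r := ⌊(n : ℝ) / Real.exp 1⌋₊
  have hget : ∀ j (hj : j < ((List.ofFn π).drop r).length),
      ((List.ofFn π).drop r)[j] = π ⟨r + j, by simp at hj; omega⟩ := by
    intro j hj
    simp
  have hlen : (k : ℕ) - r < ((List.ofFn π).drop r).length := by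
    simp
    omega
  have hkm : ((List.ofFn π).drop r)[(k : ℕ) - r] = m := by
    rw [hget, ← hπ.1]
    congr 1
    ext
    simp
    omega
  have := I.hireFirst_of_find (P := fun j => ∀ i ∈ (List.ofFn π).take r, I.Beats j i) hlen ?_ ?_
  · rw [hkm] at this
    exact this
  · intro i _
    rw [hkm, beats_iff]
    exact hm i
  · intro j hj hP
    rw [hget] at hP
    have hmem : π l ∈ (List.ofFn π).take r := by
      rw [List.mem_take_iff_getElem]
      exact ⟨l, by simp; omega, by simp⟩
    have h1 := I.beats_iff.1 (hP _ hmem)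
    have h2 := hπ.2 ⟨r + j, by omega⟩ (by rw [Fin.lt_def]; simp; omega)
    have := congrArg Fin.val (π.injective (I.rank_injective (le_antisymm h1 h2)))
    simp at this
    omega

theorem dynkin_winners_of_floor_eq_zero (h0 : ⌊(n : ℝ) / Real.exp 1⌋₊ = 0) (hn : 0 < n)
    (π : Equiv.Perm (Fin n)) : (I.dynkin (List.ofFn π)).winners = {π ⟨0, hn⟩} := by
  unfold dynkin
  rw [h0]
  have := I.hireFirst_of_find (P := fun j => ∀ i ∈ (List.ofFn π).take 0, I.Beats j i)
    (l := (List.ofFn π).drop 0) (k := 0) (by simpa using hn) (by simp) (by simp)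
  simpa using this

/-- The successful orders are sorted by the position `k` of `m` and the position `l` of her best
predecessor. Each pair with `l < r ≤ k` accounts for `n! / (n * k)` orders, which gives the sum
bounded in `inv_exp_one_le_dynkin_sum`. -/
theorem dynkin_guarantee (m : Fin n) (hm : ∀ i, I.rank i ≤ I.rank m) :
    1 / Real.exp 1 * I.value {m} ≤
      (∑ π : Equiv.Perm (Fin n), I.value (I.dynkin (List.ofFn π)).winners) / n.factorial := by
  classical
  have hn : 0 < n := m.pos
  have hfac : (0 : ℝ) < n.factorial := by exact_mod_cast n.factorial_pos
  have hnpos : (0 : ℝ) < n := by exact_mod_cast hn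
  have hm0 := I.value_nonneg {m}
  suffices h : ∃ H : Finset (Equiv.Perm (Fin n)),
      (∀ π ∈ H, (I.dynkin (List.ofFn π)).winners = {m}) ∧
      1 / Real.exp 1 * n.factorial ≤ (H.card : ℝ) by
    obtain ⟨H, hH, hcard⟩ := h
    rw [le_div_iff₀ hfac]
    calc 1 / Real.exp 1 * I.value {m} * n.factorial
        = 1 / Real.exp 1 * n.factorial * I.value {m} := by ring
      _ ≤ H.card * I.value {m} := mul_le_mul_of_nonneg_right hcard hm0
      _ = ∑ π ∈ H, I.value (I.dynkin (List.ofFn π)).winners := by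
          rw [Finset.sum_congr rfl fun π hπ => by rw [hH π hπ], Finset.sum_const, nsmul_eq_mul]
      _ ≤ _ := Finset.sum_le_univ_sum_of_nonneg fun π => I.value_nonneg _
  set r := ⌊(n : ℝ) / Real.exp 1⌋₊ with hr
  rcases Nat.lt_or_ge n 3 with hn3 | hn3
  -- With at most two agents the sample is empty and the first agent is hired; she is `m` with
  -- probability `1 / n ≥ 1 / 2 > 1 / e`.
  · have h0 : r = 0 := by
      rw [hr, Nat.floor_eq_zero, div_lt_one (Real.exp_pos 1)]
      have : (n : ℝ) ≤ 2 := by exact_mod_cast Nat.lt_succ_iff.1 hn3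
      linarith [Real.exp_one_gt_d9]
    refine ⟨Finset.univ.filter fun π => π ⟨0, hn⟩ = m, fun π hπ => ?_, ?_⟩
    · rw [I.dynkin_winners_of_floor_eq_zero h0 hn, (Finset.mem_filter.1 hπ).2]
    · have hc := card_perm_apply_eq ⟨0, hn⟩ m
      rw [← hc]
      push_cast
      rw [← mul_assoc]
      refine mul_le_of_le_one_left (Nat.cast_nonneg _) ?_
      rw [one_div, inv_mul_le_iff₀ (Real.exp_pos 1)]
      have : (n : ℝ) ≤ 2 := by exact_mod_cast Nat.lt_succ_iff.1 hn3
      linarith [Real.exp_one_gt_d9]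
  · have hsum := inv_exp_one_le_dynkin_sum hn3
    rw [← hr] at hsum
    have hr0 : 0 < r := by
      rw [hr, Nat.floor_pos, le_div_iff₀ (Real.exp_pos 1)]
      have : (3 : ℝ) ≤ n := by exact_mod_cast hn3
      linarith [Real.exp_one_lt_d9]
    have hrn : r ≤ n := by
      have h1 : (r : ℝ) ≤ n / Real.exp 1 := Nat.floor_le (by positivity)
      have : (r : ℝ) ≤ n :=
        h1.trans (div_le_self hnpos.le (by linarith [Real.exp_one_gt_d9]))
      exact_mod_cast this
    let K : Finset (Fin n) := Finset.univ.filter fun k => r ≤ k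
    let L : Finset (Fin n) := Finset.univ.filter fun l => (l : ℕ) < r
    let A : Fin n × Fin n → Finset (Equiv.Perm (Fin n)) := fun x =>
      Finset.univ.filter fun π => π x.1 = m ∧ ∀ j < x.1, I.rank (π j) ≤ I.rank (π x.2)
    have hlt : ∀ x ∈ K ×ˢ L, x.2 < x.1 := by
      intro x hx
      simp only [K, L, Finset.mem_product, Finset.mem_filter, Finset.mem_univ, true_and] at hx
      exact Fin.lt_def.2 (hx.2.trans_le hx.1)
    refine ⟨(K ×ˢ L).biUnion A, fun π hπ => ?_, ?_⟩
    · obtain ⟨x, hx, hπ⟩ := Finset.mem_biUnion.1 hπ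
      simp only [K, L, Finset.mem_product, Finset.mem_filter, Finset.mem_univ, true_and] at hx
      exact I.dynkin_winners hm hx.1 hx.2 (Finset.mem_filter.1 hπ).2
    · have hdisj : ∀ x ∈ K ×ˢ L, ∀ y ∈ K ×ˢ L, x ≠ y → Disjoint (A x) (A y) := by
        intro x hx y hy hne
        rw [Finset.disjoint_left]
        intro π hπx hπy
        simp only [A, Finset.mem_filter, Finset.mem_univ, true_and] at hπx hπy
        have h1 : x.1 = y.1 := π.injective (hπx.1.trans hπy.1.symm)
        refine hne (Prod.ext h1 (π.injective (I.rank_injective (le_antisymm ?_ ?_))))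
        · exact hπy.2 _ (h1 ▸ hlt x hx)
        · exact hπx.2 _ (h1 ▸ hlt y hy)
      rw [Finset.card_biUnion hdisj]
      push_cast
      have hA : ∀ x ∈ K ×ˢ L, ((A x).card : ℝ) = n.factorial / n * (1 / (x.1 : ℕ)) := by
        intro x hx
        have hx1 : (0 : ℝ) < (x.1 : ℕ) := by
          have := Fin.lt_def.1 (hlt x hx)
          exact_mod_cast (Nat.zero_le _).trans_lt this
        have : ((n * (x.1 * (A x).card) : ℕ) : ℝ) = n.factorial :=
          congrArg Nat.cast (card_perm_best_before I.rank_injective m (hlt x hx))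
        rw [← this]
        push_cast
        field_simp
      have hL : L.card = r := by
        simp only [L]
        rw [Fin.card_filter_val_lt, min_eq_right hrn]
      have hK : ∑ k ∈ K, (1 : ℝ) / (k : ℕ) = ∑ k ∈ Finset.Ico r n, (1 : ℝ) / k := by
        simp only [K]
        rw [Finset.sum_filter,
          Fin.sum_univ_eq_sum_range (fun k => if r ≤ k then (1 : ℝ) / k else 0),
          ← Finset.sum_filter]
        refine Finset.sum_congr ?_ fun _ _ => rfl
        ext k
        simp [and_comm]
      rw [Finset.sum_congr rfl hA, ← Finset.mul_sum, Finset.sum_product]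
      simp only [Finset.sum_const, hL, nsmul_eq_mul]
      rw [← Finset.mul_sum, hK]
      calc 1 / Real.exp 1 * n.factorial ≤ _ := mul_le_mul_of_nonneg_right hsum hfac.le
        _ = _ := by ring

end Instance
end BudgetFeasible

/-! ### Guarantees of the mechanisms -/

namespace BudgetFeasible
namespace Instance

variable {n : ℕ} (I : Instance n)

theorem expectedValue_nonneg (M : List (Fin n) → PMF (Outcome n)) : 0 ≤ I.expectedValue M := by
  rw [expectedValue_eq]
  exact div_nonneg (Finset.sum_nonneg fun _ _ => I.mean_nonneg _) (Nat.cast_nonneg _)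

theorem le_expectedValue {M : List (Fin n) → PMF (Outcome n)} {c : ℝ}
    (h : ∀ π : Equiv.Perm (Fin n), c ≤ I.mean (M (List.ofFn π))) : c ≤ I.expectedValue M := by
  have hfac : (0 : ℝ) < n.factorial := by exact_mod_cast n.factorial_pos
  rw [expectedValue_eq, le_div_iff₀ hfac]
  have := Finset.card_nsmul_le_sum Finset.univ _ c fun π _ => h π
  rw [Finset.card_univ, Fintype.card_perm, Fintype.card_fin, nsmul_eq_mul] at this
  linarith

theorem expectedValue_mix (p : unitInterval) (M M' : List (Fin n) → PMF (Outcome n)) :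
    I.expectedValue (fun l => mix p (M l) (M' l)) =
      p * I.expectedValue M + (1 - p) * I.expectedValue M' := by
  simp only [expectedValue_eq, mean_mix, Finset.sum_add_distrib, ← Finset.mul_sum]
  ring

theorem le_value_hireFirst {c : ℝ} {l : List (Fin n)} {j : Fin n} (hj : j ∈ l)
    (hc : c ≤ I.value {j}) : c ≤ I.value (I.hireFirst (fun j => c ≤ I.value {j}) l).winners := by
  classical
  unfold hireFirst
  split
  · rename_i h
    rw [List.find?_eq_none] at h
    exact absurd hc (by simpa using h j hj)
  · rename_i i h
    simpa using List.find?_some h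

/-- The bound holds for every arrival order. An agent worth `a * ω / z` makes the first branch
succeed; otherwise that number serves as `θ` in `runPricing_guarantee`, whose two alternatives give
the other two terms of `f₁`. -/
theorem predictionMechanism_guarantee {Sstar : Finset (Fin n)} (hS : I.IsOptimal Sstar)
    {ε ω : ℝ} (hε₁ : ε < 1) (hω : ω = (1 - ε) * I.value Sstar) (p : unitInterval)
    {a z : ℝ} (ha : 0 < a) (hz : 0 < z) :
    f₁ p a z ε * I.value Sstar ≤ I.expectedValue (I.predictionMechanism p a z ω) := by
  have hp0 : (0 : ℝ) ≤ p := p.2.1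
  have hp1 : (0 : ℝ) ≤ 1 - p := sub_nonneg.2 p.2.2
  rcases (I.value_nonneg Sstar).eq_or_lt with hV | hV
  · rw [← hV, mul_zero]
    exact I.expectedValue_nonneg _
  have hωpos : 0 < ω := hω ▸ mul_pos (by linarith) hV
  refine I.le_expectedValue fun π => ?_
  rw [predictionMechanism, mean_mix, mean_pure, mean_twoSolutions]
  have hm0 : 0 ≤ I.value (I.hireFirst (fun j => a * ω / z ≤ I.value {j}) (List.ofFn π)).winners :=
    I.value_nonneg _
  have hmem : ∀ i, i ∈ List.ofFn π := fun i => List.mem_ofFn.2 ⟨π.symm i, by simp⟩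
  by_cases hex : ∃ j, a * ω / z ≤ I.value {j}
  · obtain ⟨j, hj⟩ := hex
    have h1 := mul_le_mul_of_nonneg_left (I.le_value_hireFirst (hmem j) hj) hp0
    have h2 := mul_le_mul_of_nonneg_right
      (min_le_left _ _ : f₁ p a z ε ≤ a * (1 - ε) * p / z) hV.le
    have h3 : a * (1 - ε) * p / z * I.value Sstar = p * (a * ω / z) := by
      rw [hω]
      ring
    rw [h3] at h2
    refine h2.trans (h1.trans (le_add_of_nonneg_right (mul_nonneg hp1 ?_)))
    exact div_nonneg (add_nonneg (I.value_nonneg _) (I.value_nonneg _)) (by norm_num)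
  · simp only [not_exists, not_le] at hex
    refine le_trans ?_ (le_add_of_nonneg_left (mul_nonneg hp0 hm0))
    rcases I.runPricing_guarantee (mul_pos ha hωpos) (List.nodup_ofFn.2 π.injective)
      (fun i _ => (hex i).le) (O := Sstar) (fun i _ => List.mem_toFinset.2 (hmem i)) hS.1
      with h | h
    · have h2 := mul_le_mul_of_nonneg_right
        (((min_le_right _ _).trans (min_le_right _ _)) :
          f₁ p a z ε ≤ (1 - p) * a * (1 - ε) * ((z - 1) / (2 * z))) hV.le
      refine h2.trans ?_
      have h3 : (1 - p) * a * (1 - ε) * ((z - 1) / (2 * z)) * I.value Sstar =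
          (1 - p) * ((a * ω - a * ω / z) / 2) := by
        rw [hω]
        field_simp
      rw [h3]
      exact mul_le_mul_of_nonneg_left (by linarith) hp1
    · have h2 := mul_le_mul_of_nonneg_right
        (((min_le_right _ _).trans (min_le_left _ _)) :
          f₁ p a z ε ≤ (1 - p) * (1 / 4 - (1 - ε) * a / 2)) hV.le
      refine h2.trans ?_
      have h3 : (1 - p) * (1 / 4 - (1 - ε) * a / 2) * I.value Sstar =
          (1 - p) * (I.value Sstar / 4 - a * ω / 2) := by
        rw [hω]
        ring
      rw [h3]
      exact mul_le_mul_of_nonneg_left (by linarith) hp1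

/-- Sampling half of the agents and posting prices to the others. -/
theorem sampling_guarantee {Sstar : Finset (Fin n)} (hS : I.IsOptimal Sstar)
    {β δ θ m : ℝ} (hV : 0 < I.value Sstar) (hβ : 0 < β) (hδ : 0 < δ) (hδ₂ : δ < 1 / 2)
    (hθ : 0 < θ) (hvθ : ∀ i, I.value {i} ≤ θ) (hm : 0 ≤ m)
    (hm₁ : m ≤ (1 / 8 - δ / 4 - β / 2) * I.value Sstar)
    (hm₂ : m ≤ (β / Real.exp 1 * (1 / 2 - δ) * I.value Sstar - θ) / 2)
    (solver : Finset (Fin n) → PMF (Finset (Fin n)))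
    (hsolver : ∀ N₁, ∀ T₁ ∈ (solver N₁).support,
      I.IsApproxSolution (1 / Real.exp 1) N₁ T₁) :
    (1 - 2 * Real.exp (-(2 * δ ^ 2 * I.value Sstar / θ))) * m ≤
      I.expectedValue fun arrivals => (fairBinomial n).bind fun ξ =>
        (solver (arrivals.take ξ).toFinset).bind fun T₁ =>
          I.twoSolutions (β * I.value T₁) (arrivals.drop ξ) := by
  classical
  obtain ⟨w, hw0, hwv, hwV, hwX⟩ := I.exists_weights hS
  set V := I.value Sstar with hVdef
  have he := Real.exp_pos 1
  have hfac : (0 : ℝ) < n.factorial := by exact_mod_cast n.factorial_pos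
  let good : Finset (Fin n) → Prop := fun X =>
    (1 / 2 - δ) * V ≤ ∑ i ∈ X, w i ∧ (1 / 2 - δ) * V ≤ ∑ i ∈ Xᶜ, w i
  have hinter : ∀ X, I.Feasible (Sstar ∩ X) := fun X =>
    (Finset.sum_le_sum_of_subset_of_nonneg Finset.inter_subset_left
      fun x _ _ => (I.cost_pos x).le).trans hS.1
  have hpoint : ∀ (π : Equiv.Perm (Fin n)) (k : ℕ),
      (if good ((List.ofFn π).take k).toFinset then m else 0) ≤
      I.mean ((solver ((List.ofFn π).take k).toFinset).bind fun T₁ =>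
          I.twoSolutions (β * I.value T₁) ((List.ofFn π).drop k)) := by
    intro π k
    split_ifs with hgood
    · refine I.le_mean_bind _ _ _ fun T₁ hT₁ => ?_
      obtain ⟨-, hfeas, happrox⟩ := hsolver _ T₁ hT₁
      set X := ((List.ofFn π).take k).toFinset
      -- The sampled part of the optimum is a feasible competitor for `T₁`, while `T₁` itself is
      -- worth at most `V`; this confines the threshold from both sides.
      have hT_lower : 1 / Real.exp 1 * ((1 / 2 - δ) * V) ≤ I.value T₁ :=
        (mul_le_mul_of_nonneg_left (hgood.1.trans (hwX X)) (by positivity)).trans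
          (happrox _ Finset.inter_subset_right (hinter X))
      have hT_upper : I.value T₁ ≤ V := hS.2 _ hfeas
      have hT_pos : 0 < I.value T₁ :=
        lt_of_lt_of_le (mul_pos (by positivity) (mul_pos (by linarith) hV)) hT_lower
      have hO : Sstar ∩ Xᶜ ⊆ ((List.ofFn π).drop k).toFinset := by
        intro i hi
        have hi := (Finset.mem_inter.1 hi).2
        have hmem : i ∈ List.ofFn π := List.mem_ofFn.2 ⟨π.symm i, by simp⟩
        rw [← List.take_append_drop k (List.ofFn π), List.mem_append] at hmem
        rw [Finset.mem_compl] at hi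
        exact List.mem_toFinset.2 (hmem.resolve_left fun h => hi (List.mem_toFinset.2 h))
      rw [mean_twoSolutions]
      have ht_lower := mul_le_mul_of_nonneg_left hT_lower hβ.le
      have ht_eq : β * (1 / Real.exp 1 * ((1 / 2 - δ) * V)) =
          β / Real.exp 1 * (1 / 2 - δ) * V := by ring
      have ht_upper := mul_le_mul_of_nonneg_left hT_upper hβ.le
      rcases I.runPricing_guarantee (mul_pos hβ hT_pos)
        ((List.nodup_ofFn.2 π.injective).sublist (List.drop_sublist k _))
        (fun i _ => hvθ i) hO (hinter _) with h | h
      · linarith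
      · have := hgood.2.trans (hwX _)
        linarith
    · exact I.mean_nonneg _
  rw [expectedValue_eq, le_div_iff₀ hfac]
  simp only [mean_bind_fairBinomial]
  -- With the sample size outermost, the average over orders and sizes becomes an average over
  -- uniformly random subsets.
  rw [Finset.sum_comm]
  simp only [← Finset.mul_sum]
  have hlower := sum_choose_mul_sum_perm_take fun X => if good X then m else 0
  have hhalves := card_filter_halves w hw0 (fun i => (hwv i).trans (hvθ i)) hwV hV hθ hδ.le
  rw [Fintype.card_fin] at hhalves
  rw [Finset.sum_ite, Finset.sum_const, Finset.sum_const_zero, add_zero, nsmul_eq_mul] at hlower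
  calc (1 - 2 * Real.exp (-(2 * δ ^ 2 * V / θ))) * m * n.factorial
      = n.factorial * (2 ^ n * (1 - 2 * Real.exp (-(2 * δ ^ 2 * V / θ))) * m / 2 ^ n) := by
        field_simp
    _ ≤ n.factorial * ((Finset.univ.filter good).card * m / 2 ^ n) := by
        refine mul_le_mul_of_nonneg_left ?_ hfac.le
        exact div_le_div_of_nonneg_right (mul_le_mul_of_nonneg_right hhalves hm) (by positivity)
    _ = _ := hlower.symm
    _ ≤ _ := by
        refine Finset.sum_le_sum fun k _ => mul_le_mul_of_nonneg_left ?_ (by positivity)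
        exact Finset.sum_le_sum fun π _ => hpoint π k

theorem expectedValue_dynkin_guarantee (j : Fin n) :
    1 / Real.exp 1 * I.value {j} ≤
      I.expectedValue fun arrivals => PMF.pure (I.dynkin arrivals) := by
  obtain ⟨m, -, hm⟩ := Finset.exists_max_image Finset.univ I.rank ⟨j, Finset.mem_univ j⟩
  have hjm : I.value {j} ≤ I.value {m} := by
    rcases I.beats_iff.2 (hm j (Finset.mem_univ j)) with h | h
    · exact h.le
    · exact h.1.le
  simp only [expectedValue_eq, mean_pure]
  exact (mul_le_mul_of_nonneg_left hjm (by positivity)).trans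
    (I.dynkin_guarantee m fun i => hm i (Finset.mem_univ i))

/-- The Bernstein-type bound `pTilde` is weaker than the Hoeffding bound. -/
theorem pTilde_le {β z δ : ℝ} (hβ : 0 < β) (hz : 0 < z) (hδ : 0 < δ) (hδ₂ : δ < 1 / 2) :
    pTilde β z δ ≤
      1 - 2 * Real.exp (-(2 * δ ^ 2 / (β / (z * Real.exp 1) * (1 / 2 - δ)))) := by
  have he := Real.exp_pos 1
  have hc : 0 < β / (z * Real.exp 1) * (1 / 2 - δ) :=
    mul_pos (by positivity) (by linarith)
  rw [pTilde]
  set c := β / (z * Real.exp 1) * (1 / 2 - δ)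
  -- Dropping `δ / 3` from the denominator only increases the left side, and then equality holds.
  have : δ ^ 2 / 2 / (c * (1 / 4 + δ / 3)) ≤ 2 * δ ^ 2 / c := by
    rw [div_le_div_iff₀ (by positivity) hc]
    have : 0 ≤ δ ^ 2 * c * δ := by positivity
    linarith
  have := Real.exp_le_exp.2 (neg_le_neg this)
  linarith

theorem samplingMechanism_guarantee {Sstar : Finset (Fin n)} (hS : I.IsOptimal Sstar)
    (q : unitInterval) {β z δ : ℝ} (hβ : 0 < β) (hz : 1 ≤ z) (hδ : 0 < δ)
    (solver : Finset (Fin n) → PMF (Finset (Fin n)))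
    (hsolver : ∀ N₁, ∀ T₁ ∈ (solver N₁).support,
      I.IsApproxSolution (1 / Real.exp 1) N₁ T₁) :
    f₂ q β z δ * I.value Sstar ≤ I.expectedValue (I.samplingMechanism q β solver) := by
  have he := Real.exp_pos 1
  have hz0 : 0 < z := by linarith
  have hq0 : (0 : ℝ) ≤ q := q.2.1
  have hq1 : (0 : ℝ) ≤ 1 - q := sub_nonneg.2 q.2.2
  rcases (I.value_nonneg Sstar).eq_or_lt with hV | hV
  · rw [← hV, mul_zero]
    exact I.expectedValue_nonneg _
  -- Only positive `f₂` needs work, and its positivity fixes the signs: the first term forces `δ < 1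
  -- / 2`, the third makes `(1 - q) * pTilde β z δ` positive, and then the second makes `1 / 8 - δ /
  -- 4 - β / 2` positive.
  rcases le_or_gt (f₂ q β z δ) 0 with hf | hf
  · exact (mul_nonpos_of_nonpos_of_nonneg hf hV.le).trans (I.expectedValue_nonneg _)
  have hf1 : 0 < q / Real.exp 1 * (β / z) * (1 / Real.exp 1) * (1 / 2 - δ) :=
    hf.trans_le (min_le_left _ _)
  have hδ₂ : δ < 1 / 2 := by
    have : 0 ≤ q / Real.exp 1 * (β / z) * (1 / Real.exp 1) := by positivity
    linarith [pos_of_mul_pos_right hf1 this]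
  have hδ₂' : 0 < 1 / 2 - δ := by linarith
  have hc3 : 0 ≤ (z - 1) / (2 * z) * (β / Real.exp 1) * (1 / 2 - δ) :=
    mul_nonneg (mul_nonneg (div_nonneg (by linarith) (by linarith)) (by positivity)) hδ₂'.le
  have hf3 : 0 < (1 - q) * pTilde β z δ * ((z - 1) / (2 * z) * (β / Real.exp 1) * (1 / 2 - δ)) :=
    hf.trans_le ((min_le_right _ _).trans (min_le_right _ _))
  have hf2 : 0 < (1 - q) * pTilde β z δ * (1 / 8 - δ / 4 - β / 2) :=
    hf.trans_le ((min_le_right _ _).trans (min_le_left _ _))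
  have hp : 0 ≤ (1 - q) * pTilde β z δ := (pos_of_mul_pos_left hf3 hc3).le
  have hc2 : 0 < 1 / 8 - δ / 4 - β / 2 := pos_of_mul_pos_right hf2 hp
  have hmix := I.expectedValue_mix q (fun arrivals => PMF.pure (I.dynkin arrivals))
    (fun arrivals => (fairBinomial n).bind fun ξ =>
      (solver (arrivals.take ξ).toFinset).bind fun T₁ =>
        I.twoSolutions (β * I.value T₁) (arrivals.drop ξ))
  change I.expectedValue (I.samplingMechanism q β solver) = _ at hmix
  rw [hmix]
  -- This is `1 / z` times the smallest threshold, relative to the optimum, that a good sample can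
  -- produce; exhausting a budget then leaves the fraction `(z - 1) / z` of that threshold.
  set θ' := β / (z * Real.exp 1) * (1 / 2 - δ) with hθ'
  have hθ'pos : 0 < θ' := mul_pos (by positivity) hδ₂'
  by_cases hex : ∃ j, θ' * I.value Sstar ≤ I.value {j}
  · obtain ⟨j, hj⟩ := hex
    refine le_trans ?_ (le_add_of_nonneg_right (mul_nonneg hq1 (I.expectedValue_nonneg _)))
    refine le_trans ?_ (mul_le_mul_of_nonneg_left (I.expectedValue_dynkin_guarantee j) hq0)
    refine (mul_le_mul_of_nonneg_right (min_le_left _ _) hV.le).trans ?_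
    have h1 : q / Real.exp 1 * (β / z) * (1 / Real.exp 1) * (1 / 2 - δ) * I.value Sstar =
        q * (1 / Real.exp 1 * (θ' * I.value Sstar)) := by
      rw [hθ']
      field_simp
    rw [h1]
    exact mul_le_mul_of_nonneg_left (mul_le_mul_of_nonneg_left hj (by positivity)) hq0
  · simp only [not_exists, not_le] at hex
    refine le_trans ?_ (le_add_of_nonneg_left (mul_nonneg hq0 (I.expectedValue_nonneg _)))
    set m := min (1 / 8 - δ / 4 - β / 2) ((z - 1) / (2 * z) * (β / Real.exp 1) * (1 / 2 - δ))
      with hm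
    have hm0 : 0 ≤ m := le_min hc2.le hc3
    have hguar := I.sampling_guarantee hS hV hβ hδ hδ₂ (mul_pos hθ'pos hV)
      (fun i => (hex i).le) (m := m * I.value Sstar) (mul_nonneg hm0 hV.le)
      (mul_le_mul_of_nonneg_right (min_le_left _ _) hV.le)
      ((mul_le_mul_of_nonneg_right (min_le_right _ _) hV.le).trans (le_of_eq (by
        rw [hθ']
        field_simp))) solver hsolver
    rw [mul_div_mul_right _ _ hV.ne'] at hguar
    have hle : f₂ q β z δ ≤ (1 - q) * pTilde β z δ * m := by
      rw [f₂, hm, mul_min_of_nonneg _ _ hp]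
      exact min_le_right _ _
    calc f₂ q β z δ * I.value Sstar
        ≤ (1 - q) * pTilde β z δ * m * I.value Sstar := mul_le_mul_of_nonneg_right hle hV.le
      _ = (1 - q) * (pTilde β z δ * (m * I.value Sstar)) := by ring
      _ ≤ _ := mul_le_mul_of_nonneg_left
        ((mul_le_mul_of_nonneg_right (pTilde_le hβ hz0 hδ hδ₂)
          (mul_nonneg hm0 hV.le)).trans hguar) hq1

end Instance
end BudgetFeasible

theorem mainTheorem6 {n : ℕ} (I : BudgetFeasible.Instance n)
    (Sstar : Finset (Fin n)) (hSstar : I.IsOptimal Sstar)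
    (ε ω : ℝ) (hε₀ : 0 ≤ ε) (hε₁ : ε < 1) (hω : ω = (1 - ε) * I.value Sstar)
    (τ p q : unitInterval) (hτ : (τ : ℝ) < 1)
    (a z₁ : ℝ) (ha : 0 < a) (hz₁ : 0 < z₁)
    (β z₂ δ : ℝ) (hβ : 0 < β) (hz₂ : 1 ≤ z₂) (hδ : 0 < δ)
    (solver : Finset (Fin n) → PMF (Finset (Fin n)))
    (hsolver : ∀ N₁, ∀ T₁ ∈ (solver N₁).support,
      I.IsApproxSolution (1 / Real.exp 1) N₁ T₁) :
    BudgetFeasible.f₁ p a z₁ ε * I.value Sstar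
        ≤ I.expectedValue (I.predictionMechanism p a z₁ ω) ∧
    BudgetFeasible.f₂ q β z₂ δ * I.value Sstar
        ≤ I.expectedValue (I.samplingMechanism q β solver) ∧
    (τ * BudgetFeasible.f₁ p a z₁ ε + (1 - τ) * BudgetFeasible.f₂ q β z₂ δ) * I.value Sstar
        ≤ I.expectedValue (I.combinedMechanism τ p q a z₁ ω β solver) ∧
    (0 < τ * BudgetFeasible.f₁ p a z₁ ε + (1 - τ) * BudgetFeasible.f₂ q β z₂ δ →
      I.value Sstar
        ≤ (τ * BudgetFeasible.f₁ p a z₁ ε + (1 - τ) * BudgetFeasible.f₂ q β z₂ δ)⁻¹ *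
          I.expectedValue (I.combinedMechanism τ p q a z₁ ω β solver)) := by
  have h₁ := I.predictionMechanism_guarantee hSstar hε₁ hω p ha hz₁
  have h₂ := I.samplingMechanism_guarantee hSstar q hβ hz₂ hδ solver hsolver
  have hmix := I.expectedValue_mix τ (I.predictionMechanism p a z₁ ω)
    (I.samplingMechanism q β solver)
  change I.expectedValue (I.combinedMechanism τ p q a z₁ ω β solver) = _ at hmix
  have h₃ : (τ * BudgetFeasible.f₁ p a z₁ ε + (1 - τ) * BudgetFeasible.f₂ q β z₂ δ) *
      I.value Sstar ≤ I.expectedValue (I.combinedMechanism τ p q a z₁ ω β solver) := by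
    rw [hmix, add_mul, mul_assoc, mul_assoc]
    exact add_le_add (mul_le_mul_of_nonneg_left h₁ τ.2.1)
      (mul_le_mul_of_nonneg_left h₂ (sub_nonneg.2 τ.2.2))
  refine ⟨h₁, h₂, h₃, fun hpos => ?_⟩
  rw [inv_mul_eq_div, le_div_iff₀ hpos, mul_comm]
  exact h₃
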